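/- Let $\mathcal X,\mathcal Y\subseteq\mathbb R^d$ be Lebesgue measurable, and let $U^\pi:\mathcal X\to\mathbb R$, $U^\rho:\mathcal Y\to\mathbb R$ be measurable with $\int_{\mathcal X}e^{-U^\pi(x)}\,dx=\int_{\mathcal Y}e^{-U^\rho(y)}\,dy=1$; let $\pi,\rho$ be the probability measures with densities $e^{-U^\pi},e^{-U^\rho}$. Let $f:\mathcal X\times\mathcal Y\to\mathbb R$ be bounded and measurable, $F(\nu,\mu)=\int_{\mathcal Y}\int_{\mathcal X}f(x,y)\,\nu(dx)\,\mu(dy)$ for probability measures $\nu\in\mathcal P(\mathcal X)$, $\mu\in\mathcal P(\mathcal Y)$, and let $\sigma>0$, $\alpha>0$. Put $$V^\sigma(\nu,\mu)=F(\nu,\mu)+\tfrac{\sigma^2}{2}\big(D_{KL}(\nu|\pi)-D_{KL}(\mu|\rho)\big),\qquad \mathrm{NI}(\nu,\mu)=\sup_{\mu'\in\mathcal P(\mathcal Y)}V^\sigma(\nu,\mu')-\inf_{\nu'\in\mathcal P(\mathcal X)}V^\sigma(\nu',\mu)\in(-\infty,\infty],$$ where $D_{KL}$ takes values in $[0,\infty]$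 and is $\infty$ on measures that are not absolutely continuous. Let $\frac{\delta F}{\delta\nu},\frac{\delta F}{\delta\mu}$ be the normalized flat derivatives of $F$, namely $\frac{\delta F}{\delta\nu}(\nu,\mu,x)=\int f(x,y)\,\mu(dy)-F(\nu,\mu)$ and $\frac{\delta F}{\delta\mu}(\nu,\mu,y)=\int f(x,y)\,\nu(dx)-F(\nu,\mu)$, and let $\Psi_\sigma(\nu,\mu)$, $\Phi_\sigma(\nu,\mu)$ be the probability measures with Lebesgue densities $$\Psi_\sigma(\nu,\mu)(x)=\tfrac1{Z(\nu,\mu)}e^{-\frac{2}{\sigma^2}\frac{\delta F}{\delta\nu}(\nu,\mu,x)-U^\pi(x)},\qquad \Phi_\sigma(\nu,\mu)(y)=\tfrac1{Z'(\nu,\mu)}e^{\frac{2}{\sigma^2}\frac{\delta F}{\delta\mu}(\nu,\mu,y)-U^\rho(y)},$$ $Z,Z'$ being the normalizing constants. Let $(\nu_t,\mu_t)_{t\ge0}$ be a mean-field best response (MF-BR) flow, that is, a pair of curves of absolutely continuous probability measures on $\mathcal X$ and $\mathcal Y$ with $$d\nu_t=\alpha\big(\Psi_\sigma(\nu_t,\mu_t)-\nu_t\big)\,dt,\qquad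 d\mu_t=\alpha\big(\Phi_\sigma(\nu_t,\mu_t)-\mu_t\big)\,dt,\qquad t\ge0,$$ these equations being understood on every measurable set. If $\mathrm{NI}(\nu_0,\mu_0)<\infty$, then $$\mathrm{NI}(\nu_t,\mu_t)\le e^{-\alpha t}\,\mathrm{NI}(\nu_0,\mu_0)\qquad\text{for all }t\ge0.$$ In particular the rate $e^{-\alpha t}$ does not depend on $\sigma$. -/

import Mathlib

open MeasureTheory InformationTheory

/- Subsets of `ℝ^d` carry the Lebesgue measure of `ℝ^d`. -/
attribute [instance] Measure.Subtype.measureSpace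

noncomputable section

namespace MFBR

/-- The convex combination `m + ε (m' - m)` of two probability measures, `ε ∈ [0, 1]`. -/
def mix {M : Type*} [MeasurableSpace M] (ε : unitInterval) (m m' : ProbabilityMeasure M) :
    ProbabilityMeasure M :=
  ⟨ENNReal.ofReal (1 - ε) • (m : Measure M) + ENNReal.ofReal ε • (m' : Measure M), ⟨by
    have h0 := ε.2.1
    have h1 := ε.2.2
    simp only [Measure.coe_add, Measure.coe_smul, Pi.add_apply, Pi.smul_apply, measure_univ,
      smul_eq_mul, mul_one]
    rw [← ENNReal.ofReal_add (by linarith) h0]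
    simp⟩⟩

/-- `g` is the (bounded, normalized) flat derivative of `F : 𝒫(M) → ℝ`:
`F(m') - F(m) = ∫₀¹ ∫ g(m + ε (m' - m), x) (m' - m)(dx) dε` and `∫ g(m, x) m(dx) = 0`.
Of the regularity in `(m, x)` that is usually required (joint continuity for the weak topology
on measures), only measurability in `x` and continuity in `m` along segments are kept: this still
determines `g` uniquely, see `IsFlatDeriv.unique`. -/
structure IsFlatDeriv {M : Type*} [MeasurableSpace M] (F : ProbabilityMeasure M → ℝ)
    (g : ProbabilityMeasure M → M → ℝ) : Prop where
  measurable : ∀ m, Measurable (g m)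
  bounded : ∃ C : ℝ, ∀ m x, |g m x| ≤ C
  continuous_segment : ∀ m m' x, Continuous fun ε : unitInterval => g (mix ε m m') x
  sub_eq : ∀ m m' : ProbabilityMeasure M, F m' - F m = ∫ ε : unitInterval,
    ((∫ x, g (mix ε m m') x ∂(m' : Measure M)) - ∫ x, g (mix ε m m') x ∂(m : Measure M))
  normalized : ∀ m : ProbabilityMeasure M, ∫ x, g m x ∂(m : Measure M) = 0

open Classical in
/-- The flat derivative `(m, x) ↦ (δF/δm)(m, x)` of a functional `F : 𝒫(M) → ℝ`
(the junk value `0` if there is none). -/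
def flatDeriv {M : Type*} [MeasurableSpace M] (F : ProbabilityMeasure M → ℝ) :
    ProbabilityMeasure M → M → ℝ :=
  if h : ∃ g, IsFlatDeriv F g then h.choose else 0

lemma integral_mix {M : Type*} [MeasurableSpace M] (ε : unitInterval)
    (m m' : ProbabilityMeasure M) {h : M → ℝ} (hm : Integrable h (m : Measure M))
    (hm' : Integrable h (m' : Measure M)) :
    ∫ x, h x ∂(mix ε m m' : Measure M) =
      (1 - ε) * (∫ x, h x ∂(m : Measure M)) + ε * ∫ x, h x ∂(m' : Measure M) := by
  have h0 := ε.2.1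
  have h1 := ε.2.2
  change ∫ x, h x ∂(ENNReal.ofReal (1 - ε) • (m : Measure M)
    + ENNReal.ofReal ε • (m' : Measure M)) = _
  rw [integral_add_measure (hm.smul_measure ENNReal.ofReal_ne_top)
    (hm'.smul_measure ENNReal.ofReal_ne_top), integral_smul_measure, integral_smul_measure,
    ENNReal.toReal_ofReal h0, ENNReal.toReal_ofReal (by linarith)]
  rfl

lemma mix_mix {M : Type*} [MeasurableSpace M] (s ε : unitInterval)
    (m m' : ProbabilityMeasure M) : mix s m (mix ε m m') = mix (s * ε) m m' := by
  have h0 := ε.2.1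
  have h1 := ε.2.2
  have k0 := s.2.1
  have k1 := s.2.2
  apply Subtype.ext
  change ENNReal.ofReal (1 - s) • (m : Measure M) + ENNReal.ofReal s •
    (ENNReal.ofReal (1 - ε) • (m : Measure M) + ENNReal.ofReal ε • (m' : Measure M)) =
    ENNReal.ofReal (1 - (s * ε : unitInterval)) • (m : Measure M)
      + ENNReal.ofReal (s * ε : unitInterval) • (m' : Measure M)
  rw [smul_add, smul_smul, smul_smul, ← ENNReal.ofReal_mul k0, ← ENNReal.ofReal_mul k0,
    ← add_assoc, ← add_smul, ← ENNReal.ofReal_add (by linarith)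
      (mul_nonneg k0 (by linarith))]
  push_cast
  congr 3
  ring

lemma mix_zero {M : Type*} [MeasurableSpace M] (m m' : ProbabilityMeasure M) :
    mix 0 m m' = m := by
  apply Subtype.ext
  change ENNReal.ofReal (1 - (0 : unitInterval)) • (m : Measure M)
      + ENNReal.ofReal (0 : unitInterval) • (m' : Measure M) = m
  simp

lemma IsFlatDeriv.integrable {M : Type*} [MeasurableSpace M] {F : ProbabilityMeasure M → ℝ}
    {g : ProbabilityMeasure M → M → ℝ} (hg : IsFlatDeriv F g) (m n : ProbabilityMeasure M) :
    Integrable (g m) (n : Measure M) := by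
  obtain ⟨C, hC⟩ := hg.bounded
  exact Integrable.of_bound (hg.measurable m).aestronglyMeasurable C
    (Filter.Eventually.of_forall (hC m))

lemma IsFlatDeriv.continuous_integral {M : Type*} [MeasurableSpace M]
    {F : ProbabilityMeasure M → ℝ} {g : ProbabilityMeasure M → M → ℝ} (hg : IsFlatDeriv F g)
    (m m' n : ProbabilityMeasure M) :
    Continuous fun ε : unitInterval => ∫ x, g (mix ε m m') x ∂(n : Measure M) := by
  obtain ⟨C, hC⟩ := hg.bounded
  exact continuous_of_dominated (fun ε => (hg.measurable _).aestronglyMeasurable)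
    (bound := fun _ => C) (fun ε => Filter.Eventually.of_forall (hC _)) (integrable_const C)
    (Filter.Eventually.of_forall (hg.continuous_segment m m'))

/-- A functional has at most one flat derivative. -/
theorem IsFlatDeriv.unique {M : Type*} [MeasurableSpace M] {F : ProbabilityMeasure M → ℝ}
    {g₁ g₂ : ProbabilityMeasure M → M → ℝ} (h₁ : IsFlatDeriv F g₁) (h₂ : IsFlatDeriv F g₂) :
    g₁ = g₂ := by
  -- the directional derivative of `F` at `m` in the direction `m' - m` is `D g m m' 0`
  let D (g : ProbabilityMeasure M → M → ℝ) (m m' : ProbabilityMeasure M) (ε : unitInterval) : ℝ :=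
    (∫ x, g (mix ε m m') x ∂(m' : Measure M)) - ∫ x, g (mix ε m m') x ∂(m : Measure M)
  have hD : ∀ g, IsFlatDeriv F g → ∀ m m', Continuous (D g m m') := fun g hg m m' =>
    (hg.continuous_integral m m' m').sub (hg.continuous_integral m m' m)
  have hscale : ∀ g, IsFlatDeriv F g → ∀ m m', ∀ ε : unitInterval,
      F (mix ε m m') - F m = ε * ∫ s : unitInterval, D g m m' (s * ε) := by
    intro g hg m m' ε
    rw [hg.sub_eq m (mix ε m m'), ← integral_const_mul]
    congr 1
    ext s
    rw [mix_mix, integral_mix ε m m' (hg.integrable _ _) (hg.integrable _ _)]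
    simp only [D]
    ring
  have hlim : ∀ g, IsFlatDeriv F g → ∀ m m',
      Continuous fun ε : unitInterval => ∫ s : unitInterval, D g m m' (s * ε) := by
    intro g hg m m'
    have hc := hD g hg m m'
    obtain ⟨C, hC⟩ := (isCompact_range hc).isBounded.exists_norm_le
    refine continuous_of_dominated (bound := fun _ => C) (fun ε => ?_) (fun ε => ?_)
      (integrable_const C) (Filter.Eventually.of_forall fun s => ?_)
    · exact (hc.comp (continuous_id.mul continuous_const)).aestronglyMeasurable
    · exact Filter.Eventually.of_forall fun s => hC _ ⟨_, rfl⟩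
    · exact hc.comp (continuous_const.mul continuous_id)
  have hzero : ∀ m m', D g₁ m m' 0 = D g₂ m m' 0 := by
    intro m m'
    have key : (fun ε : unitInterval => ∫ s : unitInterval, D g₁ m m' (s * ε)) =
        fun ε : unitInterval => ∫ s : unitInterval, D g₂ m m' (s * ε) := by
      refine Continuous.ext_on (s := {0}ᶜ) (dense_compl_singleton 0) (hlim _ h₁ m m')
        (hlim _ h₂ m m') ?_
      intro ε hε
      have hε' : (ε : ℝ) ≠ 0 := fun h => hε (Subtype.ext h)
      exact mul_left_cancel₀ hε' ((hscale _ h₁ m m' ε).symm.trans (hscale _ h₂ m m' ε))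
    have := congrFun key 0
    simpa using this
  funext m x
  obtain ⟨δ, hδ⟩ : ∃ δ : ProbabilityMeasure M, (δ : Measure M) = Measure.dirac x :=
    ⟨⟨Measure.dirac x, Measure.dirac.isProbabilityMeasure⟩, rfl⟩
  have hx := hzero m δ
  simp only [D, mix_zero, h₁.normalized, h₂.normalized, sub_zero, hδ] at hx
  rwa [integral_dirac' _ _ (h₁.measurable m).stronglyMeasurable,
    integral_dirac' _ _ (h₂.measurable m).stronglyMeasurable] at hx

lemma IsFlatDeriv.flatDeriv_eq {M : Type*} [MeasurableSpace M] {F : ProbabilityMeasure M → ℝ}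
    {g : ProbabilityMeasure M → M → ℝ} (hg : IsFlatDeriv F g) : flatDeriv F = g := by
  have h : ∃ g, IsFlatDeriv F g := ⟨g, hg⟩
  rw [flatDeriv, dif_pos h]
  exact h.choose_spec.unique hg

/-- A linear functional `m ↦ ∫ φ dm`, `φ` bounded, has flat derivative `φ(x) - ∫ φ dm`. -/
theorem isFlatDeriv_integral {M : Type*} [MeasurableSpace M] {φ : M → ℝ} (hφ : Measurable φ)
    (hb : ∃ C : ℝ, ∀ x, |φ x| ≤ C) :
    IsFlatDeriv (fun m : ProbabilityMeasure M => ∫ x, φ x ∂(m : Measure M))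
      (fun m x => φ x - ∫ z, φ z ∂(m : Measure M)) := by
  obtain ⟨C, hC⟩ := hb
  have hint : ∀ m : ProbabilityMeasure M, Integrable φ (m : Measure M) := fun m =>
    Integrable.of_bound hφ.aestronglyMeasurable C (Filter.Eventually.of_forall hC)
  refine ⟨fun m => hφ.sub measurable_const, ⟨C + C, fun m x => ?_⟩, fun m m' x => ?_,
    fun m m' => ?_, fun m => ?_⟩
  · have h1 : |∫ z, φ z ∂(m : Measure M)| ≤ C := by
      have := norm_integral_le_of_norm_le_const (μ := (m : Measure M)) (f := φ) (C := C)
        (Filter.Eventually.of_forall hC)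
      simpa using this
    exact (abs_sub _ _).trans (add_le_add (hC x) h1)
  · simp only [integral_mix _ m m' (hint m) (hint m')]
    fun_prop
  · have : ∀ n : ProbabilityMeasure M, ∀ c : ℝ, ∫ x, (φ x - c) ∂(n : Measure M) =
        (∫ x, φ x ∂(n : Measure M)) - c := fun n c => by
      rw [integral_sub (hint n) (integrable_const c)]
      simp
    simp only [this, sub_sub_sub_cancel_right]
    simp
  · rw [integral_sub (hint _) (integrable_const _)]
    simp

/-- The bilinear payoff `F(ν, μ) = ∫ ∫ f(x, y) ν(dx) μ(dy)`. -/
def bilinearPayoff {A B : Type*} [MeasurableSpace A] [MeasurableSpace B] (f : A → B → ℝ)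
    (ν : ProbabilityMeasure A) (μ : ProbabilityMeasure B) : ℝ :=
  ∫ y, ∫ x, f x y ∂(ν : Measure A) ∂(μ : Measure B)

lemma abs_integral_le_of_abs_le {M : Type*} [MeasurableSpace M] (m : ProbabilityMeasure M)
    {φ : M → ℝ} {C : ℝ} (hC : ∀ x, |φ x| ≤ C) : |∫ x, φ x ∂(m : Measure M)| ≤ C := by
  have := norm_integral_le_of_norm_le_const (μ := (m : Measure M)) (f := φ) (C := C)
    (Filter.Eventually.of_forall hC)
  simpa using this

/-- For `f` bounded and measurable, `(δF/δν)(ν, μ, x) = ∫ f(x, y) μ(dy) - F(ν, μ)`. -/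
theorem flatDeriv_bilinearPayoff_left {A B : Type*} [MeasurableSpace A] [MeasurableSpace B]
    {f : A → B → ℝ} (hf : Measurable (Function.uncurry f)) (hb : ∃ C : ℝ, ∀ x y, |f x y| ≤ C)
    (ν : ProbabilityMeasure A) (μ : ProbabilityMeasure B) (x : A) :
    flatDeriv (fun ν' => bilinearPayoff f ν' μ) ν x =
      (∫ y, f x y ∂(μ : Measure B)) - bilinearPayoff f ν μ := by
  obtain ⟨C, hC⟩ := hb
  have hswap : ∀ ν' : ProbabilityMeasure A, bilinearPayoff f ν' μ =
      ∫ x, (∫ y, f x y ∂(μ : Measure B)) ∂(ν' : Measure A) := fun ν' =>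
    (integral_integral_swap (Integrable.of_bound hf.aestronglyMeasurable C
      (Filter.Eventually.of_forall fun p => hC p.1 p.2))).symm
  have hφ : Measurable fun x => ∫ y, f x y ∂(μ : Measure B) :=
    (hf.stronglyMeasurable.integral_prod_right).measurable
  have := (isFlatDeriv_integral hφ ⟨C, fun x => abs_integral_le_of_abs_le μ (hC x)⟩).flatDeriv_eq
  simp only [hswap, this]

/-- For `f` bounded and measurable, `(δF/δμ)(ν, μ, y) = ∫ f(x, y) ν(dx) - F(ν, μ)`. -/
theorem flatDeriv_bilinearPayoff_right {A B : Type*} [MeasurableSpace A] [MeasurableSpace B]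
    {f : A → B → ℝ} (hf : Measurable (Function.uncurry f)) (hb : ∃ C : ℝ, ∀ x y, |f x y| ≤ C)
    (ν : ProbabilityMeasure A) (μ : ProbabilityMeasure B) (y : B) :
    flatDeriv (fun μ' => bilinearPayoff f ν μ') μ y =
      (∫ x, f x y ∂(ν : Measure A)) - bilinearPayoff f ν μ := by
  obtain ⟨C, hC⟩ := hb
  have hφ : Measurable fun y => ∫ x, f x y ∂(ν : Measure A) :=
    (hf.stronglyMeasurable.integral_prod_left).measurable
  have := (isFlatDeriv_integral hφ
    ⟨C, fun y => abs_integral_le_of_abs_le ν fun x => hC x y⟩).flatDeriv_eq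
  simp only [bilinearPayoff, this]

/-- The reference measure with Lebesgue density `exp (-U)`. -/
def refMeasure {A : Type*} [MeasureSpace A] (U : A → ℝ) : Measure A :=
  volume.withDensity fun x => ENNReal.ofReal (Real.exp (-U x))

/-- The best response `Ψ_σ(ν, μ)` of the minimizing player: the probability measure with density
`exp (-(2/σ²) (δF/δν)(ν, μ, x) - U(x)) / Z(ν, μ)`, `Z(ν, μ)` being the normalizing constant. -/
def bestResponseMin {A B : Type*} [MeasureSpace A] [MeasurableSpace B]
    (F : ProbabilityMeasure A → ProbabilityMeasure B → ℝ) (U : A → ℝ) (σ : ℝ)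
    (ν : ProbabilityMeasure A) (μ : ProbabilityMeasure B) : Measure A :=
  volume.tilted fun x => -(2 / σ ^ 2) * flatDeriv (fun ν' => F ν' μ) ν x - U x

/-- The best response `Φ_σ(ν, μ)` of the maximizing player: the probability measure with density
`exp ((2/σ²) (δF/δμ)(ν, μ, y) - U(y)) / Z'(ν, μ)`, `Z'(ν, μ)` being the normalizing constant. -/
def bestResponseMax {A B : Type*} [MeasurableSpace A] [MeasureSpace B]
    (F : ProbabilityMeasure A → ProbabilityMeasure B → ℝ) (U : B → ℝ) (σ : ℝ)
    (ν : ProbabilityMeasure A) (μ : ProbabilityMeasure B) : Measure B :=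
  volume.tilted fun y => 2 / σ ^ 2 * flatDeriv (fun μ' => F ν μ') μ y - U y

/-- `(ν_t, μ_t)_{t ≥ 0}` is a mean-field best response flow with learning rate `α`: a pair of
curves of absolutely continuous probability measures with
`dν_t = α (Ψ_σ(ν_t, μ_t) - ν_t) dt`, `dμ_t = α (Φ_σ(ν_t, μ_t) - μ_t) dt` for all `t ≥ 0`.
The equations are read as identities between measures, evaluated at every measurable set (with the
one-sided derivative at `t = 0`). Only the values at times `t ≥ 0` matter. -/
structure IsMFBRFlow {A B : Type*} [MeasureSpace A] [MeasureSpace B]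
    (F : ProbabilityMeasure A → ProbabilityMeasure B → ℝ) (Uπ : A → ℝ) (Uρ : B → ℝ) (σ α : ℝ)
    (ν : ℝ → ProbabilityMeasure A) (μ : ℝ → ProbabilityMeasure B) : Prop where
  ac_min : ∀ t, 0 ≤ t → (ν t : Measure A) ≪ volume
  ac_max : ∀ t, 0 ≤ t → (μ t : Measure B) ≪ volume
  deriv_min : ∀ S : Set A, MeasurableSet S → ∀ t, 0 ≤ t →
    HasDerivWithinAt (fun s => (ν s : Measure A).real S)
      (α * ((bestResponseMin F Uπ σ (ν t) (μ t)).real S - (ν t : Measure A).real S))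
      (Set.Ici 0) t
  deriv_max : ∀ S : Set B, MeasurableSet S → ∀ t, 0 ≤ t →
    HasDerivWithinAt (fun s => (μ s : Measure B).real S)
      (α * ((bestResponseMax F Uρ σ (ν t) (μ t)).real S - (μ t : Measure B).real S))
      (Set.Ici 0) t

/-- The regularized payoff `V^σ(ν, μ) = F(ν, μ) + (σ²/2) (KL(ν | π) - KL(μ | ρ))`, with values in
`[-∞, ∞]`. The value in the indeterminate case `KL(ν | π) = KL(μ | ρ) = ∞` is immaterial below:
it never affects the supremum and the infimum in `niError`, because `π` and `ρ` are
competitors with zero relative entropy. -/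
def regPayoff {A B : Type*} [MeasureSpace A] [MeasureSpace B]
    (F : ProbabilityMeasure A → ProbabilityMeasure B → ℝ) (Uπ : A → ℝ) (Uρ : B → ℝ) (σ : ℝ)
    (ν : ProbabilityMeasure A) (μ : ProbabilityMeasure B) : EReal :=
  (F ν μ : EReal) + ((σ ^ 2 / 2 : ℝ) : EReal) *
    ((klDiv (ν : Measure A) (refMeasure Uπ) : EReal) -
      (klDiv (μ : Measure B) (refMeasure Uρ) : EReal))

/-- The Nikaidô-Isoda error
`NI(ν, μ) = sup_{μ'} V^σ(ν, μ') - inf_{ν'} V^σ(ν', μ)`, with values in `[-∞, ∞]`. -/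
def niError {A B : Type*} [MeasureSpace A] [MeasureSpace B]
    (F : ProbabilityMeasure A → ProbabilityMeasure B → ℝ) (Uπ : A → ℝ) (Uρ : B → ℝ) (σ : ℝ)
    (ν : ProbabilityMeasure A) (μ : ProbabilityMeasure B) : EReal :=
  (⨆ μ' : ProbabilityMeasure B, regPayoff F Uπ Uρ σ ν μ') -
    ⨅ ν' : ProbabilityMeasure A, regPayoff F Uπ Uρ σ ν' μ

end MFBR

end

/-! Write `p = π`, `q = ρ`, `k = (2/σ²) f`, `u = -∫ k dμ`, `v = ∫ k dν` and `Λ_p(g) = log ∫ exp g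
dp`. The best responses are the tilted measures `Ψ = p.tilted u` and `Φ = q.tilted v`: the
normalizing term `F(ν, μ)` of the flat derivatives is a constant and tilting ignores it. By the
Gibbs variational principle, when both entropies are finite, `(2/σ²) NI(ν, μ) = KL(ν|p) + KL(μ|q) +
Λ_q(v) + Λ_p(u)` (`niError_bilinearPayoff`).

Differentiating the entropies along the flow would require control of log-densities. Instead each
entropy is replaced by a Donsker–Varadhan lower bound `∫ g dν - Λ_p(g)`, `∫ h dμ - Λ_q(h)` with
bounded `g`, `h` fixed in time. Let `L(t)` be the resulting sum. Only integrals of bounded functions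
have to be differentiated. The derivatives of the two log-moments contain `∫∫ k dΨ dΦ` with opposite
signs, so bilinearity cancels it. Moreover `∫ g dΨ - Λ_p(g) ≤ KL(Ψ|p) = ∫ u dΨ - Λ_p(u)`, and
likewise for `Φ`. What remains is `L' ≤ -α L`, that is, `exp(αt) L(t)` decreases
(`exp_mul_dual_le`).

Bounding `L(0)` by the true entropies and then taking suprema over `h` and `g` at time `t` gives the
decay, and also finiteness of the entropies at time `t` (`klDiv_add_responseGap_decay`). The
parameter `σ` enters only through `k` and an overall factor, hence not the rate. -/

noncomputable section
namespace MFBR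
open Real Filter Topology

variable {M : Type*} [MeasurableSpace M]

/-! ### Log-moments and the Gibbs variational principle. -/

/-- The logarithmic moment `log ∫ exp u dp`. -/
def logMeanExp (p : Measure M) (u : M → ℝ) : ℝ := log (∫ x, exp (u x) ∂p)

lemma integrable_of_abs_le (m : Measure M) [IsFiniteMeasure m] {g : M → ℝ} {C : ℝ}
    (hg : Measurable g) (hC : ∀ x, |g x| ≤ C) : Integrable g m :=
  Integrable.of_bound hg.aestronglyMeasurable C (Eventually.of_forall hC)

lemma integrable_exp_of_abs_le (m : Measure M) [IsFiniteMeasure m] {g : M → ℝ} {C : ℝ}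
    (hg : Measurable g) (hC : ∀ x, |g x| ≤ C) : Integrable (fun x => exp (g x)) m := by
  refine integrable_of_abs_le m (C := exp C) hg.exp fun x => ?_
  rw [abs_of_pos (exp_pos _)]
  exact exp_le_exp.2 (abs_le.1 (hC x)).2

lemma integral_exp_pos_of_abs_le (m : Measure M) [IsProbabilityMeasure m] {g : M → ℝ} {C : ℝ}
    (hg : Measurable g) (hC : ∀ x, |g x| ≤ C) : 0 < ∫ x, exp (g x) ∂m :=
  integral_exp_pos (integrable_exp_of_abs_le m hg hC)

lemma integral_zero_sub_logMeanExp_zero (m p : Measure M) [IsProbabilityMeasure p] :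
    ∫ _ : M, (0 : ℝ) ∂m - logMeanExp p (fun _ => 0) = 0 := by
  simp [logMeanExp]

/-- The Donsker–Varadhan inequality. -/
lemma integral_sub_logMeanExp_le_klDiv {m p : Measure M} [IsProbabilityMeasure m]
    [IsProbabilityMeasure p] (h : klDiv m p ≠ ⊤) {g : M → ℝ} {C : ℝ} (hg : Measurable g)
    (hC : ∀ x, |g x| ≤ C) : ∫ x, g x ∂m - logMeanExp p g ≤ (klDiv m p).toReal := by
  obtain ⟨hac, hint⟩ := klDiv_ne_top_iff.1 h
  have hexp := integrable_exp_of_abs_le p hg hC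
  have hprob : IsProbabilityMeasure (p.tilted g) := isProbabilityMeasure_tilted hexp
  have hgi := integrable_of_abs_le m hg hC
  -- The inequality is `KL(m | p.tilted g) ≥ 0`, because `KL(m | p.tilted g) = KL(m|p) - ∫ g dm +
  -- log ∫ exp g dp`.
  have h1 := integral_llr_tilted_right hac hgi hexp hint
  have hac' : m ≪ p.tilted g := hac.trans (absolutelyContinuous_tilted hexp)
  have h2 := integral_llr_add_sub_measure_univ_nonneg hac'
    (integrable_llr_tilted_right hac hgi hint hexp)
  rw [toReal_klDiv_of_measure_eq hac (by simp)]
  simp only [probReal_univ] at h2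
  simp only [logMeanExp]
  linarith

/-- Equality holds in the Donsker–Varadhan inequality for tilted measures. -/
lemma klDiv_tilted {p : Measure M} [IsProbabilityMeasure p] {u : M → ℝ} {C : ℝ}
    (hu : Measurable u) (hC : ∀ x, |u x| ≤ C) : klDiv (p.tilted u) p ≠ ⊤ ∧
      (klDiv (p.tilted u) p).toReal = ∫ x, u x ∂(p.tilted u) - logMeanExp p u := by
  have hexp := integrable_exp_of_abs_le p hu hC
  have hprob : IsProbabilityMeasure (p.tilted u) := isProbabilityMeasure_tilted hexp
  have hac := tilted_absolutelyContinuous p u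
  have hllr : llr (p.tilted u) p =ᵐ[p.tilted u] fun x => u x - logMeanExp p u :=
    hac.ae_le (log_rnDeriv_tilted_left_self hexp)
  have hui := integrable_of_abs_le (p.tilted u) hu hC
  refine ⟨klDiv_ne_top hac ((hui.sub (integrable_const _)).congr hllr.symm), ?_⟩
  rw [toReal_klDiv_of_measure_eq hac (by simp), integral_congr_ae hllr,
    integral_sub hui (integrable_const _)]
  simp

/-- The right side is the entropy of `p.tilted u`, so `u` is itself an optimal test function for
that measure. -/
lemma integral_tilted_sub_logMeanExp_le {p : Measure M} [IsProbabilityMeasure p] {g u : M → ℝ}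
    {C D : ℝ} (hg : Measurable g) (hC : ∀ x, |g x| ≤ C) (hu : Measurable u)
    (hD : ∀ x, |u x| ≤ D) : ∫ x, g x ∂(p.tilted u) - logMeanExp p g ≤
      ∫ x, u x ∂(p.tilted u) - logMeanExp p u := by
  have hprob : IsProbabilityMeasure (p.tilted u) :=
    isProbabilityMeasure_tilted (integrable_exp_of_abs_le p hu hD)
  obtain ⟨h1, h2⟩ := klDiv_tilted hu hD (p := p)
  exact h2 ▸ integral_sub_logMeanExp_le_klDiv h1 hg hC

/-! ### Recovering the entropy from bounded test functions. -/

/-- The positive truncation of `r` to the interval `[exp (-n), exp n]`. -/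
def expClamp (n : ℕ) (r : ℝ) : ℝ := max (exp (-n)) (min r (exp n))

lemma exp_neg_le_expClamp (n : ℕ) (r : ℝ) : exp (-n) ≤ expClamp n r := le_max_left _ _

lemma expClamp_pos (n : ℕ) (r : ℝ) : 0 < expClamp n r :=
  (exp_pos _).trans_le (exp_neg_le_expClamp n r)

lemma expClamp_le_exp (n : ℕ) (r : ℝ) : expClamp n r ≤ exp n :=
  max_le (exp_le_exp.2 (by linarith [(Nat.cast_nonneg n : (0 : ℝ) ≤ n)])) (min_le_right _ _)

lemma abs_log_expClamp_le (n : ℕ) (r : ℝ) : |log (expClamp n r)| ≤ n := by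
  rw [abs_le]
  constructor
  · rw [le_log_iff_exp_le (expClamp_pos n r)]
    exact exp_neg_le_expClamp n r
  · rw [log_le_iff_le_exp (expClamp_pos n r)]
    exact expClamp_le_exp n r

lemma measurable_expClamp (n : ℕ) : Measurable (expClamp n) := by
  unfold expClamp
  fun_prop

/-- With `c = expClamp n r` the expression is `klFun c + (r - c) log c`, and where `r ≠ c` the
truncation makes `r - c` and `log c` have compatible signs. Nonnegativity is what permits Fatou's
lemma below. -/
lemma mul_log_expClamp_nonneg (n : ℕ) (r : ℝ) :
    0 ≤ r * log (expClamp n r) - expClamp n r + 1 := by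
  have key := klFun_nonneg (expClamp_pos n r).le
  rw [klFun_apply] at key
  suffices h : 0 ≤ (r - expClamp n r) * log (expClamp n r) by nlinarith
  have hn : (0 : ℝ) ≤ n := Nat.cast_nonneg n
  have hnn : exp (-(n : ℝ)) ≤ exp n := exp_le_exp.2 (by linarith)
  rcases le_total r (exp (-n)) with h1 | h1
  · have : expClamp n r = exp (-n) := max_eq_left ((min_le_left _ _).trans h1)
    rw [this, log_exp]
    nlinarith
  · rcases le_total r (exp n) with h2 | h2
    · have : expClamp n r = r := by rw [expClamp, min_eq_left h2, max_eq_right h1]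
      simp [this]
    · have : expClamp n r = exp n := by rw [expClamp, min_eq_right h2, max_eq_right hnn]
      rw [this, log_exp]
      nlinarith

lemma tendsto_mul_log_expClamp {r : ℝ} (hr : 0 ≤ r) :
    Tendsto (fun n : ℕ => r * log (expClamp n r) - expClamp n r + 1) atTop (𝓝 (klFun r)) := by
  rcases hr.eq_or_lt with rfl | hr
  · have h : Tendsto (fun n : ℕ => exp (-(n : ℝ))) atTop (𝓝 0) :=
      tendsto_exp_neg_atTop_nhds_zero.comp tendsto_natCast_atTop_atTop
    have h0 : ∀ n : ℕ, expClamp n 0 = exp (-n) := fun n =>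
      max_eq_left ((min_le_left _ _).trans (exp_pos _).le)
    simp only [h0, zero_mul, klFun_zero, zero_sub]
    simpa using h.neg.add_const 1
  · refine tendsto_const_nhds.congr' ?_
    have h1 : ∀ᶠ n : ℕ in atTop, |log r| ≤ n :=
      tendsto_natCast_atTop_atTop.eventually (eventually_ge_atTop _)
    filter_upwards [h1] with n hn
    rw [abs_le] at hn
    have h2 : exp (-n) ≤ r := (le_log_iff_exp_le hr).1 hn.1
    have h3 : r ≤ exp n := (log_le_iff_le_exp hr).1 hn.2
    rw [expClamp, min_eq_left h3, max_eq_right h2, klFun_apply]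
    ring

/-- The relative entropy is the least constant in the Donsker–Varadhan inequality. -/
lemma klDiv_le_ofReal_of_forall {m p : Measure M} [IsProbabilityMeasure m]
    [IsProbabilityMeasure p] (hac : m ≪ p) {K : ℝ}
    (h : ∀ g : M → ℝ, Measurable g → (∃ C, ∀ x, |g x| ≤ C) →
      ∫ x, g x ∂m - logMeanExp p g ≤ K) : klDiv m p ≤ ENNReal.ofReal K := by
  set r : M → ℝ := fun x => (m.rnDeriv p x).toReal with hr
  have hrm : Measurable r := (Measure.measurable_rnDeriv m p).ennreal_toReal
  have hri : Integrable r p := Measure.integrable_toReal_rnDeriv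
  have hcm : ∀ n, Measurable fun x => expClamp n (r x) := fun n => (measurable_expClamp n).comp hrm
  have hlm : ∀ n, Measurable fun x => log (expClamp n (r x)) := fun n =>
    measurable_log.comp (hcm n)
  set G : ℕ → M → ℝ := fun n x => r x * log (expClamp n (r x)) - expClamp n (r x) + 1 with hG
  have hGm : ∀ n, Measurable (G n) := fun n => ((hrm.mul (hlm n)).sub (hcm n)).add_const 1
  -- The test function is the truncated log-density `log (expClamp n r)`. Its log-moment is `log ∫ c
  -- dp ≤ ∫ c dp - 1`, which turns the hypothesis into a bound on `∫ G n dp`.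
  have hbound : ∀ n, ∫⁻ x, ENNReal.ofReal (G n x) ∂p ≤ ENNReal.ofReal K := by
    intro n
    have hei : Integrable (fun x => expClamp n (r x)) p :=
      integrable_of_abs_le p (C := exp n) (hcm n) fun x => by
        rw [abs_of_pos (expClamp_pos _ _)]; exact expClamp_le_exp n _
    have hli : Integrable (fun x => r x * log (expClamp n (r x))) p :=
      hri.mul_bdd (c := n) (hlm n).aestronglyMeasurable
        (Eventually.of_forall fun x => abs_log_expClamp_le n _)
    have hGi : Integrable (G n) p := (hli.sub hei).add (integrable_const 1)
    rw [← ofReal_integral_eq_lintegral_ofReal hGi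
      (Eventually.of_forall fun x => mul_log_expClamp_nonneg n (r x))]
    refine ENNReal.ofReal_le_ofReal (le_trans ?_ (h _ (hlm n) ⟨n, fun x => abs_log_expClamp_le n _⟩))
    have h1 : ∫ x, G n x ∂p = ∫ x, r x * log (expClamp n (r x)) ∂p
        - ∫ x, expClamp n (r x) ∂p + 1 := by
      simp only [hG]
      rw [integral_add (f := fun x => r x * log (expClamp n (r x)) - expClamp n (r x))
        (hli.sub hei) (integrable_const 1), integral_sub hli hei]
      simp
    have h2 : ∫ x, r x * log (expClamp n (r x)) ∂p = ∫ x, log (expClamp n (r x)) ∂m :=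
      integral_rnDeriv_smul hac
    have h3 : ∫ x, exp (log (expClamp n (r x))) ∂p = ∫ x, expClamp n (r x) ∂p := by
      simp only [exp_log (expClamp_pos _ _)]
    have h4 : 0 < ∫ x, expClamp n (r x) ∂p := h3 ▸
      integral_exp_pos_of_abs_le p (hlm n) fun x => abs_log_expClamp_le n _
    rw [h1, h2, logMeanExp, h3]
    linarith [log_le_sub_one_of_pos h4]
  rw [klDiv_eq_lintegral_klFun_of_ac hac]
  -- Fatou's lemma, since `G n` tends pointwise to `klFun r`.
  calc ∫⁻ x, ENNReal.ofReal (klFun (r x)) ∂p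
      = ∫⁻ x, liminf (fun n => ENNReal.ofReal (G n x)) atTop ∂p := by
        refine lintegral_congr fun x => ?_
        exact (ENNReal.tendsto_ofReal
          (tendsto_mul_log_expClamp ENNReal.toReal_nonneg)).liminf_eq.symm
    _ ≤ liminf (fun n => ∫⁻ x, ENNReal.ofReal (G n x) ∂p) atTop :=
        lintegral_liminf_le fun n => (hGm n).ennreal_ofReal
    _ ≤ ENNReal.ofReal K := by
        refine liminf_le_of_frequently_le' (Eventually.of_forall hbound).frequently

/-! ### From the equation on sets to integrals of bounded functions. -/

/-- A bounded measurable function is a uniform limit of simple functions. -/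
lemma exists_simpleFunc_abs_sub_le {g : M → ℝ} {C : ℝ} (hg : Measurable g)
    (hC : ∀ x, |g x| ≤ C) (n : ℕ) : ∃ φ : SimpleFunc M ℝ, ∀ x, |φ x - g x| ≤ 1 / (n + 1) := by
  have hn : (0 : ℝ) < n + 1 := by positivity
  have hfl : Measurable fun x => ⌊(n + 1) * g x⌋ := Int.measurable_floor.comp (hg.const_mul _)
  have hm : Measurable fun x => (⌊(n + 1) * g x⌋ : ℝ) / (n + 1) :=
    (measurable_from_top.comp hfl).div_const _
  have hfin : (Set.range fun x => (⌊(n + 1) * g x⌋ : ℝ) / (n + 1)).Finite := by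
    refine ((Set.finite_Icc ⌊(n + 1) * (-C)⌋ ⌊(n + 1) * C⌋).image
      fun k : ℤ => (k : ℝ) / (n + 1)).subset ?_
    rintro _ ⟨x, rfl⟩
    have := abs_le.1 (hC x)
    exact ⟨_, ⟨Int.floor_le_floor (mul_le_mul_of_nonneg_left this.1 hn.le),
      Int.floor_le_floor (mul_le_mul_of_nonneg_left this.2 hn.le)⟩, rfl⟩
  refine ⟨⟨_, fun y => hm (measurableSet_singleton y), hfin⟩, fun x => ?_⟩
  change |(⌊(n + 1) * g x⌋ : ℝ) / (n + 1) - g x| ≤ 1 / (n + 1)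
  have h1 := Int.floor_le ((n + 1) * g x)
  have h2 := Int.lt_floor_add_one ((n + 1) * g x)
  have h3 : (⌊(n + 1) * g x⌋ : ℝ) / (n + 1) - g x
      = (⌊(n + 1) * g x⌋ - (n + 1) * g x) / (n + 1) := by field_simp
  rw [h3, abs_div, abs_of_pos hn]
  gcongr
  rw [abs_le]
  constructor <;> linarith

lemma abs_integral_sub_integral_le (m : Measure M) [IsProbabilityMeasure m] {g h : M → ℝ}
    {ε : ℝ} (hg : Integrable g m) (hh : Integrable h m) (hε : ∀ x, |g x - h x| ≤ ε) :
    |∫ x, g x ∂m - ∫ x, h x ∂m| ≤ ε := by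
  rw [← integral_sub hg hh]
  exact abs_integral_le_of_abs_le ⟨m, inferInstance⟩ hε

/-- The curve of probability measures `m` solves `dm_t = α (P_t - m_t) dt` for `t ≥ 0`. -/
def IsRelaxation (α : ℝ) (m : ℝ → ProbabilityMeasure M) (P : ℝ → Measure M) : Prop :=
  ∀ S : Set M, MeasurableSet S → ∀ t, 0 ≤ t →
    HasDerivWithinAt (fun s => (m s : Measure M).real S)
      (α * ((P t).real S - (m t : Measure M).real S)) (Set.Ici 0) t

namespace IsRelaxation

variable {α : ℝ} {m : ℝ → ProbabilityMeasure M} {P : ℝ → Measure M}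

/-- The integral is a finite linear combination of measures of fibres, to each of which the setwise
equation applies. -/
lemma hasDerivWithinAt_integral_simpleFunc [∀ t, IsProbabilityMeasure (P t)]
    (h : IsRelaxation α m P) (φ : SimpleFunc M ℝ) {t : ℝ} (ht : 0 ≤ t) :
    HasDerivWithinAt (fun s => ∫ x, φ x ∂(m s : Measure M))
      (α * (∫ x, φ x ∂(P t) - ∫ x, φ x ∂(m t : Measure M))) (Set.Ici 0) t := by
  have key : ∀ (n : Measure M) [IsProbabilityMeasure n],
      ∫ x, φ x ∂n = ∑ y ∈ φ.range, n.real (φ ⁻¹' {y}) * y := fun n _ => by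
    rw [← SimpleFunc.integral_eq_integral _ (SimpleFunc.integrable_of_isFiniteMeasure φ),
      SimpleFunc.integral_eq]
    rfl
  simp only [key]
  rw [← Finset.sum_sub_distrib, Finset.mul_sum]
  refine HasDerivWithinAt.fun_sum fun y _ => ?_
  refine ((h _ (φ.measurableSet_fiber y) t ht).mul_const y).congr_deriv ?_
  ring

lemma abs_integral_simpleFunc_sub_le {g : M → ℝ} {φ : ℕ → SimpleFunc M ℝ} (n : Measure M)
    [IsProbabilityMeasure n] {C : ℝ} (hg : Measurable g) (hC : ∀ x, |g x| ≤ C)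
    (hφ : ∀ n x, |φ n x - g x| ≤ 1 / (n + 1)) (k : ℕ) :
    |∫ x, φ k x ∂n - ∫ x, g x ∂n| ≤ 1 / (k + 1) :=
  abs_integral_sub_integral_le n (SimpleFunc.integrable_of_isFiniteMeasure _)
    (integrable_of_abs_le n hg hC) (hφ k)

lemma continuousOn_integral [∀ t, IsProbabilityMeasure (P t)] (h : IsRelaxation α m P)
    {g : M → ℝ} {C : ℝ} (hg : Measurable g) (hC : ∀ x, |g x| ≤ C) :
    ContinuousOn (fun s => ∫ x, g x ∂(m s : Measure M)) (Set.Ici 0) := by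
  choose φ hφ using exists_simpleFunc_abs_sub_le hg hC
  refine TendstoUniformlyOn.continuousOn (F := fun n s => ∫ x, φ n x ∂(m s : Measure M))
    (p := atTop) ?_ (Frequently.of_forall fun n t ht =>
      (h.hasDerivWithinAt_integral_simpleFunc (φ n) ht).continuousWithinAt)
  rw [Metric.tendstoUniformlyOn_iff]
  intro ε hε
  filter_upwards [tendsto_one_div_add_atTop_nhds_zero_nat.eventually (gt_mem_nhds hε)] with n hn t _
  rw [dist_comm, Real.dist_eq]
  exact (abs_integral_simpleFunc_sub_le _ hg hC hφ n).trans_lt hn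

/-- Uniform approximation of `g` by simple functions makes the derivatives converge uniformly in
time, whatever the dependence of `P` on time. Times `t > 0` suffice: at `0` the monotonicity
argument only needs continuity. -/
lemma hasDerivAt_integral [∀ t, IsProbabilityMeasure (P t)] (h : IsRelaxation α m P)
    {g : M → ℝ} {C : ℝ} (hg : Measurable g) (hC : ∀ x, |g x| ≤ C) {t : ℝ} (ht : 0 < t) :
    HasDerivAt (fun s => ∫ x, g x ∂(m s : Measure M))
      (α * (∫ x, g x ∂(P t) - ∫ x, g x ∂(m t : Measure M))) t := by
  choose φ hφ using exists_simpleFunc_abs_sub_le hg hC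
  refine hasDerivAt_of_tendstoUniformlyOn (l := atTop) (s := Set.Ioi 0)
    (f := fun n s => ∫ x, φ n x ∂(m s : Measure M))
    (f' := fun n s => α * (∫ x, φ n x ∂(P s) - ∫ x, φ n x ∂(m s : Measure M)))
    (g' := fun s => α * (∫ x, g x ∂(P s) - ∫ x, g x ∂(m s : Measure M)))
    isOpen_Ioi ?_ ?_ ?_ ht
  · rw [Metric.tendstoUniformlyOn_iff]
    intro ε hε
    have hlim : Tendsto (fun n : ℕ => |α| * (2 * (1 / ((n : ℝ) + 1)))) atTop (𝓝 0) := by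
      simpa using (tendsto_one_div_add_atTop_nhds_zero_nat.const_mul 2).const_mul |α|
    filter_upwards [hlim.eventually (gt_mem_nhds hε)] with n hn s _
    rw [dist_comm, Real.dist_eq, ← mul_sub, abs_mul]
    refine lt_of_le_of_lt (mul_le_mul_of_nonneg_left ?_ (abs_nonneg _)) hn
    have h1 := abs_le.1 (abs_integral_simpleFunc_sub_le (P s) hg hC hφ n)
    have h2 := abs_le.1 (abs_integral_simpleFunc_sub_le (m s : Measure M) hg hC hφ n)
    rw [abs_le]
    constructor <;> linarith
  · exact Eventually.of_forall fun n s hs =>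
      (h.hasDerivWithinAt_integral_simpleFunc (φ n) (le_of_lt hs)).hasDerivAt (Ici_mem_nhds hs)
  · intro s _
    rw [tendsto_iff_dist_tendsto_zero]
    refine squeeze_zero (fun _ => dist_nonneg) (fun n => ?_)
      tendsto_one_div_add_atTop_nhds_zero_nat
    rw [Real.dist_eq]
    exact abs_integral_simpleFunc_sub_le _ hg hC hφ n

variable {N : Type*} [MeasurableSpace N]

/-! ### Log-moments along the flow. -/

section logMeanExp

variable {g : N → M → ℝ} {C : ℝ} (q : Measure N) [IsProbabilityMeasure q]

lemma continuousOn_logMeanExp [∀ t, IsProbabilityMeasure (P t)] (h : IsRelaxation α m P)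
    (hg : Measurable (Function.uncurry g)) (hC : ∀ y x, |g y x| ≤ C) :
    ContinuousOn (fun s => logMeanExp q fun y => ∫ x, g y x ∂(m s : Measure M)) (Set.Ici 0) := by
  have hint : ∀ n : ProbabilityMeasure M, Measurable fun y => ∫ x, g y x ∂(n : Measure M) :=
    fun n => hg.stronglyMeasurable.integral_prod_right.measurable
  have hbd : ∀ n : ProbabilityMeasure M, ∀ y, |∫ x, g y x ∂(n : Measure M)| ≤ C := fun n y =>
    abs_integral_le_of_abs_le n (hC y)
  refine ContinuousOn.log (fun t ht => ?_) fun t _ =>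
    (integral_exp_pos_of_abs_le q (hint _) (hbd _)).ne'
  refine continuousWithinAt_of_dominated (bound := fun _ => exp C)
    (Eventually.of_forall fun s => (hint _).exp.aestronglyMeasurable)
    (Eventually.of_forall fun s => Eventually.of_forall fun y => ?_) (integrable_const _)
    (Eventually.of_forall fun y => ?_)
  · rw [Real.norm_eq_abs, abs_of_pos (exp_pos _)]
    exact exp_le_exp.2 (abs_le.1 (hbd _ y)).2
  · exact (h.continuousOn_integral (hg.of_uncurry_left (x := y)) (hC y) t ht).rexp

/-- The logarithmic derivative of `∫ exp u dq` is the average of the time derivative of `u` under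
`q.tilted u`; boundedness of `g` dominates the integrand. -/
lemma hasDerivAt_logMeanExp [∀ t, IsProbabilityMeasure (P t)] (h : IsRelaxation α m P)
    (hg : Measurable (Function.uncurry g)) (hC : ∀ y x, |g y x| ≤ C) {t : ℝ} (ht : 0 < t) :
    HasDerivAt (fun s => logMeanExp q fun y => ∫ x, g y x ∂(m s : Measure M))
      (α * (∫ y, ∫ x, g y x ∂(P t) ∂(q.tilted fun y => ∫ x, g y x ∂(m t : Measure M)) -
        ∫ y, ∫ x, g y x ∂(m t : Measure M) ∂(q.tilted fun y => ∫ x, g y x ∂(m t : Measure M))))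
      t := by
  have hint : ∀ (n : Measure M) [IsProbabilityMeasure n], Measurable fun y => ∫ x, g y x ∂n :=
    fun n _ => hg.stronglyMeasurable.integral_prod_right.measurable
  have hbd : ∀ (n : Measure M) [IsProbabilityMeasure n], ∀ y, |∫ x, g y x ∂n| ≤ C :=
    fun n hn y => abs_integral_le_of_abs_le ⟨n, hn⟩ (hC y)
  set u : ℝ → N → ℝ := fun s y => ∫ x, g y x ∂(m s : Measure M) with hu
  set v : ℝ → N → ℝ := fun s y => ∫ x, g y x ∂(P s) with hv
  have hZ : 0 < ∫ y, exp (u t y) ∂q := integral_exp_pos_of_abs_le q (hint _) (hbd _)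
  have hexp : Integrable (fun y => exp (u t y)) q := integrable_exp_of_abs_le q (hint _) (hbd _)
  have hprob : IsProbabilityMeasure (q.tilted (u t)) := isProbabilityMeasure_tilted hexp
  have hd : ∀ y, ∀ s ∈ Set.Ioi (0 : ℝ), HasDerivAt (fun s => exp (u s y))
      (exp (u s y) * (α * (v s y - u s y))) s := fun y s hs =>
    (h.hasDerivAt_integral (hg.of_uncurry_left (x := y)) (hC y) hs).exp
  obtain ⟨-, hder⟩ := hasDerivAt_integral_of_dominated_loc_of_deriv_le (μ := q)
    (F := fun s y => exp (u s y)) (F' := fun s y => exp (u s y) * (α * (v s y - u s y)))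
    (bound := fun _ => exp C * (|α| * (C + C))) (Ioi_mem_nhds ht)
    (Eventually.of_forall fun s => (hint _).exp.aestronglyMeasurable) hexp
    ((hint _).exp.mul (((hint _).sub (hint _)).const_mul α)).aestronglyMeasurable
    (Eventually.of_forall fun y s _ => by
      rw [Real.norm_eq_abs, abs_mul, abs_mul, abs_of_pos (exp_pos _)]
      have h1 := abs_le.1 (hbd (m s : Measure M) y)
      have h2 : |v s y - u s y| ≤ C + C := (abs_sub _ _).trans (add_le_add (hbd _ y) (hbd _ y))
      exact mul_le_mul (exp_le_exp.2 h1.2) (mul_le_mul_of_nonneg_left h2 (abs_nonneg _))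
        (by positivity) (exp_pos _).le)
    (integrable_const _) (Eventually.of_forall hd)
  refine (hder.log hZ.ne').congr_deriv ?_
  rw [← integral_sub (integrable_of_abs_le _ (hint _) (hbd _))
    (integrable_of_abs_le _ (hint _) (hbd _)), integral_tilted, ← integral_const_mul,
    ← integral_div]
  refine integral_congr_ae (Eventually.of_forall fun y => ?_)
  simp only [smul_eq_mul, hu, hv]
  ring

end logMeanExp

end IsRelaxation

/-! ### The Lyapunov functional and its decay. -/

variable {A B : Type*} [MeasurableSpace A] [MeasurableSpace B]

/-- The sum of the two optimal values of the entropy-regularized responses to `ν` and `μ`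
for the payoff `k` and the reference measures `p` and `q`. -/
def responseGap (p : Measure A) (q : Measure B) (k : A → B → ℝ) (ν : Measure A) (μ : Measure B) :
    ℝ :=
  logMeanExp q (fun y => ∫ x, k x y ∂ν) + logMeanExp p (fun x => ∫ y, -k x y ∂μ)

section Lyapunov

variable {p : Measure A} {q : Measure B} [IsProbabilityMeasure p] [IsProbabilityMeasure q]
  {k : A → B → ℝ} {C α : ℝ} {ν : ℝ → ProbabilityMeasure A} {μ : ℝ → ProbabilityMeasure B}

/-- For bounded test functions, the Donsker–Varadhan lower bound of the entropies plus the response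
gap, rescaled by `exp (α t)`, is at most its initial value along the flow. -/
lemma exp_mul_dual_le (hk : Measurable (Function.uncurry k)) (hC : ∀ x y, |k x y| ≤ C)
    (hα : 0 < α)
    (hν : IsRelaxation α ν fun t => p.tilted fun x => ∫ y, -k x y ∂(μ t : Measure B))
    (hμ : IsRelaxation α μ fun t => q.tilted fun y => ∫ x, k x y ∂(ν t : Measure A))
    {g : A → ℝ} {h : B → ℝ} {D E : ℝ} (hg : Measurable g) (hD : ∀ x, |g x| ≤ D)
    (hh : Measurable h) (hE : ∀ y, |h y| ≤ E) {t : ℝ} (ht : 0 ≤ t) :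
    exp (α * t) * (∫ x, g x ∂(ν t : Measure A) - logMeanExp p g
        + (∫ y, h y ∂(μ t : Measure B) - logMeanExp q h) + responseGap p q k (ν t) (μ t)) ≤
      ∫ x, g x ∂(ν 0 : Measure A) - logMeanExp p g
        + (∫ y, h y ∂(μ 0 : Measure B) - logMeanExp q h) + responseGap p q k (ν 0) (μ 0) := by
  have hk1 : Measurable (Function.uncurry fun x y => -k x y) := hk.neg
  have hk2 : Measurable (Function.uncurry fun y x => k x y) := hk.comp measurable_swap
  have hC1 : ∀ x y, |-k x y| ≤ C := fun x y => by rw [abs_neg]; exact hC x y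
  have hC2 : ∀ y x, |k x y| ≤ C := fun y x => hC x y
  have hu : ∀ t, Measurable fun x => ∫ y, -k x y ∂(μ t : Measure B) := fun t =>
    hk1.stronglyMeasurable.integral_prod_right.measurable
  have hv : ∀ t, Measurable fun y => ∫ x, k x y ∂(ν t : Measure A) := fun t =>
    hk2.stronglyMeasurable.integral_prod_right.measurable
  have huC : ∀ t x, |∫ y, -k x y ∂(μ t : Measure B)| ≤ C := fun t x =>
    abs_integral_le_of_abs_le (μ t) (hC1 x)
  have hvC : ∀ t y, |∫ x, k x y ∂(ν t : Measure A)| ≤ C := fun t y =>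
    abs_integral_le_of_abs_le (ν t) (hC2 y)
  have hP : ∀ t, IsProbabilityMeasure (p.tilted fun x => ∫ y, -k x y ∂(μ t : Measure B)) :=
    fun t => isProbabilityMeasure_tilted (integrable_exp_of_abs_le p (hu t) (huC t))
  have hQ : ∀ t, IsProbabilityMeasure (q.tilted fun y => ∫ x, k x y ∂(ν t : Measure A)) :=
    fun t => isProbabilityMeasure_tilted (integrable_exp_of_abs_le q (hv t) (hvC t))
  set H : ℝ → ℝ := fun t => exp (α * t) * (∫ x, g x ∂(ν t : Measure A) - logMeanExp p g
        + (∫ y, h y ∂(μ t : Measure B) - logMeanExp q h) + responseGap p q k (ν t) (μ t)) with hH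
  have hcont : ContinuousOn H (Set.Ici 0) := by
    refine ContinuousOn.mul (by fun_prop) ?_
    exact (((hν.continuousOn_integral hg hD).sub continuousOn_const).add
      ((hμ.continuousOn_integral hh hE).sub continuousOn_const)).add
      ((hν.continuousOn_logMeanExp q hk2 hC2).add (hμ.continuousOn_logMeanExp p hk1 hC1))
  have hder : ∀ t, 0 < t → ∃ d ≤ 0, HasDerivAt H d t := by
    intro t ht
    have hd := ((hasDerivAt_id t).const_mul α).exp.mul
      ((((hν.hasDerivAt_integral hg hD ht).sub_const (logMeanExp p g)).add
      ((hμ.hasDerivAt_integral hh hE ht).sub_const (logMeanExp q h))).add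
      ((hν.hasDerivAt_logMeanExp q hk2 hC2 ht).add (hμ.hasDerivAt_logMeanExp p hk1 hC1 ht)))
    refine ⟨_, ?_, hd⟩
    have h1 := integral_tilted_sub_logMeanExp_le (p := p) hg hD (hu t) (huC t)
    have h2 := integral_tilted_sub_logMeanExp_le (p := q) hh hE (hv t) (hvC t)
    -- The payoff between the two best responses occurs in both log-moment derivatives with opposite
    -- signs; Fubini identifies the terms.
    have hcancel : ∫ y, ∫ x, k x y ∂(p.tilted fun x => ∫ y, -k x y ∂(μ t : Measure B))
          ∂(q.tilted fun y => ∫ x, k x y ∂(ν t : Measure A)) +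
        ∫ x, ∫ y, -k x y ∂(q.tilted fun y => ∫ x, k x y ∂(ν t : Measure A))
          ∂(p.tilted fun x => ∫ y, -k x y ∂(μ t : Measure B)) = 0 := by
      rw [integral_integral_swap (integrable_of_abs_le _ hk2 fun z => hC2 z.1 z.2)]
      simp only [integral_neg]
      ring
    simp only [Pi.add_apply, id, mul_one]
    rw [mul_assoc, ← mul_add]
    refine mul_nonpos_of_nonneg_of_nonpos (exp_pos _).le ?_
    rw [← mul_add, ← mul_add, ← mul_add, ← mul_add]
    -- After cancellation the bracket is the sum of the differences of the two sides of `h1` and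
    -- `h2`.
    exact mul_nonpos_of_nonneg_of_nonpos hα.le (by linarith)
  have hanti : AntitoneOn H (Set.Ici 0) := by
    refine antitoneOn_of_deriv_nonpos (convex_Ici 0) hcont ?_ ?_
    · intro s hs
      rw [interior_Ici] at hs
      obtain ⟨d, -, hd⟩ := hder s hs
      exact hd.differentiableAt.differentiableWithinAt
    · intro s hs
      rw [interior_Ici] at hs
      obtain ⟨d, hd0, hd⟩ := hder s hs
      rwa [hd.deriv]
  simpa [hH] using hanti Set.self_mem_Ici ht ht

/-- Exponential decay of the sum of the relative entropies and the response gap. -/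
lemma klDiv_add_responseGap_decay (hk : Measurable (Function.uncurry k))
    (hC : ∀ x y, |k x y| ≤ C) (hα : 0 < α)
    (hν : IsRelaxation α ν fun t => p.tilted fun x => ∫ y, -k x y ∂(μ t : Measure B))
    (hμ : IsRelaxation α μ fun t => q.tilted fun y => ∫ x, k x y ∂(ν t : Measure A))
    (hν0 : klDiv (ν 0 : Measure A) p ≠ ⊤) (hμ0 : klDiv (μ 0 : Measure B) q ≠ ⊤) {t : ℝ}
    (ht : 0 ≤ t) (hνt : (ν t : Measure A) ≪ p) (hμt : (μ t : Measure B) ≪ q) :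
    klDiv (ν t : Measure A) p ≠ ⊤ ∧ klDiv (μ t : Measure B) q ≠ ⊤ ∧
      (klDiv (ν t : Measure A) p).toReal + (klDiv (μ t : Measure B) q).toReal
        + responseGap p q k (ν t) (μ t) ≤
      exp (-α * t) * ((klDiv (ν 0 : Measure A) p).toReal + (klDiv (μ 0 : Measure B) q).toReal
        + responseGap p q k (ν 0) (μ 0)) := by
  set K := exp (-α * t) * ((klDiv (ν 0 : Measure A) p).toReal + (klDiv (μ 0 : Measure B) q).toReal
    + responseGap p q k (ν 0) (μ 0)) - responseGap p q k (ν t) (μ t) with hK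
  have key : ∀ (g : A → ℝ) (h : B → ℝ), Measurable g → Measurable h → (∃ D, ∀ x, |g x| ≤ D) →
      (∃ E, ∀ y, |h y| ≤ E) → ∫ x, g x ∂(ν t : Measure A) - logMeanExp p g
        + (∫ y, h y ∂(μ t : Measure B) - logMeanExp q h) ≤ K := by
    rintro g h hg hh ⟨D, hD⟩ ⟨E, hE⟩
    have h1 := exp_mul_dual_le hk hC hα hν hμ hg hD hh hE ht
    have h2 := integral_sub_logMeanExp_le_klDiv hν0 hg hD
    have h3 := integral_sub_logMeanExp_le_klDiv hμ0 hh hE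
    rw [← le_div_iff₀' (exp_pos _), div_eq_inv_mul, ← exp_neg, ← neg_mul] at h1
    have h4 := h1.trans (mul_le_mul_of_nonneg_left (add_le_add_left (add_le_add h2 h3)
      (responseGap p q k (ν 0) (μ 0))) (exp_pos (-α * t)).le)
    rw [hK]
    linarith
  -- The suprema are taken one at a time: over `h` with `g` fixed, then over `g`.
  have bound_μ : ∀ g : A → ℝ, Measurable g → (∃ D, ∀ x, |g x| ≤ D) →
      klDiv (μ t : Measure B) q ≤
        ENNReal.ofReal (K - (∫ x, g x ∂(ν t : Measure A) - logMeanExp p g)) := fun g hg hD =>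
    klDiv_le_ofReal_of_forall hμt fun h hh hE => by linarith [key g h hg hh hD hE]
  have hμfin : klDiv (μ t : Measure B) q ≠ ⊤ := ne_top_of_le_ne_top ENNReal.ofReal_ne_top
    (bound_μ _ measurable_const ⟨0, fun _ => abs_zero.le⟩)
  have bound_ν : klDiv (ν t : Measure A) p ≤
      ENNReal.ofReal (K - (klDiv (μ t : Measure B) q).toReal) := by
    refine klDiv_le_ofReal_of_forall hνt fun g hg hD => ?_
    have h1 := bound_μ g hg hD
    -- `h = 0` shows that the argument of `ENNReal.ofReal` is nonnegative, so no truncation occurs.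
    have h2 := key g (fun _ => 0) hg measurable_const hD ⟨0, fun _ => abs_zero.le⟩
    rw [integral_zero_sub_logMeanExp_zero] at h2
    have h3 := ENNReal.toReal_le_of_le_ofReal (by linarith) h1
    linarith
  refine ⟨ne_top_of_le_ne_top ENNReal.ofReal_ne_top bound_ν, hμfin, ?_⟩
  have h1 := bound_μ (fun _ => 0) measurable_const ⟨0, fun _ => abs_zero.le⟩
  have h2 := key (fun _ => 0) (fun _ => 0) measurable_const measurable_const
    ⟨0, fun _ => abs_zero.le⟩ ⟨0, fun _ => abs_zero.le⟩
  rw [integral_zero_sub_logMeanExp_zero, integral_zero_sub_logMeanExp_zero] at h2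
  rw [integral_zero_sub_logMeanExp_zero] at h1
  have h3 := ENNReal.toReal_le_of_le_ofReal (by linarith) h1
  have h4 := ENNReal.toReal_le_of_le_ofReal (by linarith) bound_ν
  rw [hK] at h4
  linarith

end Lyapunov
end MFBR
end

noncomputable section
namespace MFBR
open Filter Topology

/-! ### Reference measures as tilted measures. -/

section Reference

variable {A : Type*} [MeasureSpace A] {U : A → ℝ}

/-- A non-integrable function has Bochner integral `0`, not `1`. -/
lemma integrable_exp_neg_of_integral_eq_one (hU : ∫ x, Real.exp (-U x) = 1) :
    Integrable fun x => Real.exp ((-U) x) := by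
  by_contra h
  have := integral_undef h
  simp only [Pi.neg_apply] at this
  rw [this] at hU
  exact zero_ne_one hU

lemma refMeasure_eq_tilted (hU : ∫ x, Real.exp (-U x) = 1) :
    refMeasure U = (volume : Measure A).tilted (-U) := by
  simp [refMeasure, Measure.tilted, hU]

lemma isProbabilityMeasure_refMeasure (hU : ∫ x, Real.exp (-U x) = 1) :
    IsProbabilityMeasure (refMeasure U) := by
  have : NeZero (volume : Measure A) := ⟨fun h => by simp [h] at hU⟩
  rw [refMeasure_eq_tilted hU]
  exact isProbabilityMeasure_tilted (integrable_exp_neg_of_integral_eq_one hU)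

lemma absolutelyContinuous_refMeasure (hU : ∫ x, Real.exp (-U x) = 1) :
    (volume : Measure A) ≪ refMeasure U := by
  rw [refMeasure_eq_tilted hU]
  exact absolutelyContinuous_tilted (integrable_exp_neg_of_integral_eq_one hU)

/-- Successive tiltings add exponents and a constant tilt of a probability measure is trivial. The
free `c` absorbs the normalization of the flat derivatives. -/
lemma tilted_sub_eq_refMeasure_tilted (hU : ∫ x, Real.exp (-U x) = 1) (u : A → ℝ) (c : ℝ) :
    (volume : Measure A).tilted (fun x => u x + c - U x) = (refMeasure U).tilted u := by
  have hprob := isProbabilityMeasure_refMeasure hU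
  have h1 : (refMeasure U).tilted u = ((refMeasure U).tilted fun _ => c).tilted u := by
    rw [tilted_const]
  rw [h1, tilted_tilted (integrable_const _), refMeasure_eq_tilted hU,
    tilted_tilted (integrable_exp_neg_of_integral_eq_one hU)]
  congr 1
  ext x
  simp only [Pi.add_apply, Pi.neg_apply]
  ring

end Reference

/-! ### The Nikaidô–Isoda error in terms of entropies and log-moments. -/

section Payoff

variable {A B : Type*} [MeasureSpace A] [MeasureSpace B]
  {Uπ : A → ℝ} {Uρ : B → ℝ} {f : A → B → ℝ} {C σ : ℝ}

lemma bestResponseMin_bilinearPayoff (hπ : ∫ x, Real.exp (-Uπ x) = 1)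
    (hf : Measurable (Function.uncurry f)) (hC : ∀ x y, |f x y| ≤ C)
    (ν : ProbabilityMeasure A) (μ : ProbabilityMeasure B) :
    bestResponseMin (bilinearPayoff f) Uπ σ ν μ =
      (refMeasure Uπ).tilted fun x => ∫ y, -(2 / σ ^ 2 * f x y) ∂(μ : Measure B) := by
  rw [bestResponseMin, ← tilted_sub_eq_refMeasure_tilted hπ _ (2 / σ ^ 2 * bilinearPayoff f ν μ)]
  congr 1
  ext x
  rw [flatDeriv_bilinearPayoff_left hf ⟨C, hC⟩, integral_neg, integral_const_mul]
  ring

lemma bestResponseMax_bilinearPayoff (hρ : ∫ y, Real.exp (-Uρ y) = 1)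
    (hf : Measurable (Function.uncurry f)) (hC : ∀ x y, |f x y| ≤ C)
    (ν : ProbabilityMeasure A) (μ : ProbabilityMeasure B) :
    bestResponseMax (bilinearPayoff f) Uρ σ ν μ =
      (refMeasure Uρ).tilted fun y => ∫ x, 2 / σ ^ 2 * f x y ∂(ν : Measure A) := by
  rw [bestResponseMax, ← tilted_sub_eq_refMeasure_tilted hρ _ (-(2 / σ ^ 2 * bilinearPayoff f ν μ))]
  congr 1
  ext x
  rw [flatDeriv_bilinearPayoff_right hf ⟨C, hC⟩, integral_const_mul]
  ring

lemma regPayoff_eq_coe {F : ProbabilityMeasure A → ProbabilityMeasure B → ℝ}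
    {ν : ProbabilityMeasure A} {μ : ProbabilityMeasure B}
    (hν : klDiv (ν : Measure A) (refMeasure Uπ) ≠ ⊤)
    (hμ : klDiv (μ : Measure B) (refMeasure Uρ) ≠ ⊤) :
    regPayoff F Uπ Uρ σ ν μ = ((F ν μ + σ ^ 2 / 2 *
      ((klDiv (ν : Measure A) (refMeasure Uπ)).toReal -
        (klDiv (μ : Measure B) (refMeasure Uρ)).toReal) : ℝ) : EReal) := by
  rw [regPayoff, ← EReal.coe_ennreal_toReal hν, ← EReal.coe_ennreal_toReal hμ]
  norm_cast

/-- This covers the indeterminate case too, because `⊤ - ⊤ = ⊥` in `EReal`. -/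
lemma regPayoff_eq_bot (hσ : 0 < σ) {F : ProbabilityMeasure A → ProbabilityMeasure B → ℝ}
    {ν : ProbabilityMeasure A} {μ : ProbabilityMeasure B}
    (hμ : klDiv (μ : Measure B) (refMeasure Uρ) = ⊤) :
    regPayoff F Uπ Uρ σ ν μ = ⊥ := by
  rw [regPayoff, hμ, EReal.coe_ennreal_top, EReal.sub_top,
    EReal.coe_mul_bot_of_pos (by positivity), EReal.add_bot]

lemma regPayoff_eq_top (hσ : 0 < σ) {F : ProbabilityMeasure A → ProbabilityMeasure B → ℝ}
    {ν : ProbabilityMeasure A} {μ : ProbabilityMeasure B}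
    (hν : klDiv (ν : Measure A) (refMeasure Uπ) = ⊤)
    (hμ : klDiv (μ : Measure B) (refMeasure Uρ) ≠ ⊤) :
    regPayoff F Uπ Uρ σ ν μ = ⊤ := by
  rw [regPayoff, hν, ← EReal.coe_ennreal_toReal hμ, EReal.coe_ennreal_top, EReal.top_sub_coe,
    EReal.coe_mul_top_of_pos (by positivity), EReal.coe_add_top]

variable [IsProbabilityMeasure (refMeasure Uπ)] [IsProbabilityMeasure (refMeasure Uρ)]

/-- The competitors `π` and `ρ` have zero entropy. They make one of the two extrema infinite and
keep the other from cancelling it. Hence a finite error forces finite entropies. -/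
lemma niError_eq_top (hσ : 0 < σ) {F : ProbabilityMeasure A → ProbabilityMeasure B → ℝ}
    {ν : ProbabilityMeasure A} {μ : ProbabilityMeasure B}
    (h : klDiv (ν : Measure A) (refMeasure Uπ) = ⊤ ∨ klDiv (μ : Measure B) (refMeasure Uρ) = ⊤) :
    niError F Uπ Uρ σ ν μ = ⊤ := by
  let p : ProbabilityMeasure A := ⟨refMeasure Uπ, inferInstance⟩
  let q : ProbabilityMeasure B := ⟨refMeasure Uρ, inferInstance⟩
  have hp : klDiv (p : Measure A) (refMeasure Uπ) ≠ ⊤ := by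
    change klDiv (refMeasure Uπ) (refMeasure Uπ) ≠ ⊤
    simp
  have hq : klDiv (q : Measure B) (refMeasure Uρ) ≠ ⊤ := by
    change klDiv (refMeasure Uρ) (refMeasure Uρ) ≠ ⊤
    simp
  have hsup := le_iSup (fun μ' => regPayoff F Uπ Uρ σ ν μ') q
  have hinf := iInf_le (fun ν' => regPayoff F Uπ Uρ σ ν' μ) p
  rw [niError]
  by_cases hμ : klDiv (μ : Measure B) (refMeasure Uρ) = ⊤
  · rw [regPayoff_eq_bot hσ hμ, le_bot_iff] at hinf
    rw [hinf]
    refine EReal.sub_bot (ne_bot_of_le_ne_bot ?_ hsup)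
    by_cases hν : klDiv (ν : Measure A) (refMeasure Uπ) = ⊤
    · rw [regPayoff_eq_top hσ hν hq]
      exact top_ne_bot
    · rw [regPayoff_eq_coe hν hq]
      exact EReal.coe_ne_bot _
  · rw [regPayoff_eq_top hσ (h.resolve_right hμ) hq, top_le_iff] at hsup
    rw [hsup]
    refine EReal.top_sub (ne_top_of_le_ne_top ?_ hinf)
    rw [regPayoff_eq_coe hp hμ]
    exact EReal.coe_ne_top _

/-- Each player's optimization is a Gibbs variational problem: Donsker–Varadhan bounds its value by
a log-moment and the tilted measure attains the bound. -/
lemma niError_bilinearPayoff (hf : Measurable (Function.uncurry f)) (hC : ∀ x y, |f x y| ≤ C)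
    (hσ : 0 < σ) {ν : ProbabilityMeasure A} {μ : ProbabilityMeasure B}
    (hν : klDiv (ν : Measure A) (refMeasure Uπ) ≠ ⊤)
    (hμ : klDiv (μ : Measure B) (refMeasure Uρ) ≠ ⊤) :
    niError (bilinearPayoff f) Uπ Uρ σ ν μ = ((σ ^ 2 / 2 *
      ((klDiv (ν : Measure A) (refMeasure Uπ)).toReal +
        (klDiv (μ : Measure B) (refMeasure Uρ)).toReal +
        responseGap (refMeasure Uπ) (refMeasure Uρ) (fun x y => 2 / σ ^ 2 * f x y) ν μ) : ℝ) :
        EReal) := by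
  set k : A → B → ℝ := fun x y => 2 / σ ^ 2 * f x y with hk
  set c : ℝ := σ ^ 2 / 2 with hc
  have hc0 : 0 < c := by positivity
  have hck : c * (2 / σ ^ 2) = 1 := by rw [hc]; field_simp
  set D : ℝ := 2 / σ ^ 2 * C
  have hkm : Measurable (Function.uncurry k) := hf.const_mul _
  have hkD : ∀ x y, |k x y| ≤ D := fun x y => by
    rw [hk, abs_mul, abs_of_pos (by positivity : 0 < 2 / σ ^ 2)]
    exact mul_le_mul_of_nonneg_left (hC x y) (by positivity)
  have hkD' : ∀ x y, |-k x y| ≤ D := fun x y => by rw [abs_neg]; exact hkD x y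
  have hkm2 : Measurable (Function.uncurry fun y x => k x y) := hkm.comp measurable_swap
  have hu : Measurable fun x => ∫ y, -k x y ∂(μ : Measure B) :=
    (hkm.neg : Measurable (Function.uncurry fun x y => -k x y)).stronglyMeasurable
      |>.integral_prod_right.measurable
  have hv : Measurable fun y => ∫ x, k x y ∂(ν : Measure A) :=
    hkm2.stronglyMeasurable.integral_prod_right.measurable
  have huD : ∀ x, |∫ y, -k x y ∂(μ : Measure B)| ≤ D := fun x =>
    abs_integral_le_of_abs_le μ (hkD' x)
  have hvD : ∀ y, |∫ x, k x y ∂(ν : Measure A)| ≤ D := fun y =>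
    abs_integral_le_of_abs_le ν fun x => hkD x y
  have hF1 : ∀ μ' : ProbabilityMeasure B,
      bilinearPayoff f ν μ' = c * ∫ y, ∫ x, k x y ∂(ν : Measure A) ∂(μ' : Measure B) := by
    intro μ'
    simp only [hk, integral_const_mul]
    rw [← mul_assoc, hck, one_mul, bilinearPayoff]
  have hF2 : ∀ ν' : ProbabilityMeasure A,
      bilinearPayoff f ν' μ = -(c * ∫ x, ∫ y, -k x y ∂(μ : Measure B) ∂(ν' : Measure A)) := by
    intro ν'
    simp only [hk, integral_neg, integral_const_mul]
    rw [mul_neg, neg_neg, ← mul_assoc, hck, one_mul, bilinearPayoff]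
    exact (integral_integral_swap (integrable_of_abs_le _ hf fun z => hC z.1 z.2)).symm
  have hsup : ⨆ μ', regPayoff (bilinearPayoff f) Uπ Uρ σ ν μ' =
      ((c * ((klDiv (ν : Measure A) (refMeasure Uπ)).toReal +
        logMeanExp (refMeasure Uρ) fun y => ∫ x, k x y ∂(ν : Measure A)) : ℝ) : EReal) := by
    refine le_antisymm (iSup_le fun μ' => ?_) ?_
    · by_cases h : klDiv (μ' : Measure B) (refMeasure Uρ) = ⊤
      · rw [regPayoff_eq_bot hσ h]
        exact bot_le
      · rw [regPayoff_eq_coe hν h, EReal.coe_le_coe_iff, hF1, ← hc, ← mul_add]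
        refine mul_le_mul_of_nonneg_left ?_ hc0.le
        linarith [integral_sub_logMeanExp_le_klDiv h hv hvD]
    · obtain ⟨h1, h2⟩ := klDiv_tilted (p := refMeasure Uρ) hv hvD
      let Φ : ProbabilityMeasure B := ⟨(refMeasure Uρ).tilted fun y => ∫ x, k x y ∂(ν : Measure A),
        isProbabilityMeasure_tilted (integrable_exp_of_abs_le _ hv hvD)⟩
      refine le_iSup_of_le Φ ?_
      rw [regPayoff_eq_coe (μ := Φ) hν h1, EReal.coe_le_coe_iff, hF1, ← hc, ← mul_add]
      refine mul_le_mul_of_nonneg_left ?_ hc0.le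
      simp only [Φ, ProbabilityMeasure.coe_mk]
      linarith
  have hinf : ⨅ ν', regPayoff (bilinearPayoff f) Uπ Uρ σ ν' μ =
      ((-(c * ((klDiv (μ : Measure B) (refMeasure Uρ)).toReal +
        logMeanExp (refMeasure Uπ) fun x => ∫ y, -k x y ∂(μ : Measure B))) : ℝ) : EReal) := by
    refine le_antisymm ?_ (le_iInf fun ν' => ?_)
    · obtain ⟨h1, h2⟩ := klDiv_tilted (p := refMeasure Uπ) hu huD
      let Ψ : ProbabilityMeasure A := ⟨(refMeasure Uπ).tilted fun x => ∫ y, -k x y ∂(μ : Measure B),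
        isProbabilityMeasure_tilted (integrable_exp_of_abs_le _ hu huD)⟩
      refine iInf_le_of_le Ψ ?_
      rw [regPayoff_eq_coe (ν := Ψ) h1 hμ, EReal.coe_le_coe_iff, hF2, ← hc, ← mul_neg, ← mul_neg, ← mul_add]
      refine mul_le_mul_of_nonneg_left ?_ hc0.le
      simp only [Ψ, ProbabilityMeasure.coe_mk]
      linarith
    · by_cases h : klDiv (ν' : Measure A) (refMeasure Uπ) = ⊤
      · rw [regPayoff_eq_top hσ h hμ]
        exact le_top
      · rw [regPayoff_eq_coe h hμ, EReal.coe_le_coe_iff, hF2, ← hc, ← mul_neg, ← mul_neg,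
          ← mul_add]
        refine mul_le_mul_of_nonneg_left ?_ hc0.le
        linarith [integral_sub_logMeanExp_le_klDiv h hu huD]
  rw [niError, hsup, hinf, ← EReal.coe_sub, responseGap]
  congr 1
  ring

end Payoff

/-! ### Conclusion. -/

lemma IsMFBRFlow.niError_le {A B : Type*} [MeasureSpace A] [MeasureSpace B]
    {Uπ : A → ℝ} {Uρ : B → ℝ} {f : A → B → ℝ} {C σ α : ℝ}
    {ν : ℝ → ProbabilityMeasure A} {μ : ℝ → ProbabilityMeasure B}
    (hπ : ∫ x, Real.exp (-Uπ x) = 1) (hρ : ∫ y, Real.exp (-Uρ y) = 1)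
    (hf : Measurable (Function.uncurry f)) (hC : ∀ x y, |f x y| ≤ C)
    (hσ : 0 < σ) (hα : 0 < α) (hflow : IsMFBRFlow (bilinearPayoff f) Uπ Uρ σ α ν μ)
    (hNI : niError (bilinearPayoff f) Uπ Uρ σ (ν 0) (μ 0) < ⊤) {t : ℝ} (ht : 0 ≤ t) :
    niError (bilinearPayoff f) Uπ Uρ σ (ν t) (μ t) ≤
      (Real.exp (-α * t) : EReal) * niError (bilinearPayoff f) Uπ Uρ σ (ν 0) (μ 0) := by
  have hp := isProbabilityMeasure_refMeasure hπ
  have hq := isProbabilityMeasure_refMeasure hρ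
  obtain ⟨hν0, hμ0⟩ : klDiv (ν 0 : Measure A) (refMeasure Uπ) ≠ ⊤ ∧
      klDiv (μ 0 : Measure B) (refMeasure Uρ) ≠ ⊤ := by
    by_contra h
    rw [not_and_or, not_not, not_not] at h
    exact hNI.ne (niError_eq_top hσ h)
  have hν : IsRelaxation α ν fun t => (refMeasure Uπ).tilted
      fun x => ∫ y, -(2 / σ ^ 2 * f x y) ∂(μ t : Measure B) := fun S hS t ht => by
    simpa only [bestResponseMin_bilinearPayoff hπ hf hC] using hflow.deriv_min S hS t ht
  have hμ : IsRelaxation α μ fun t => (refMeasure Uρ).tilted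
      fun y => ∫ x, 2 / σ ^ 2 * f x y ∂(ν t : Measure A) := fun S hS t ht => by
    simpa only [bestResponseMax_bilinearPayoff hρ hf hC] using hflow.deriv_max S hS t ht
  obtain ⟨hνt, hμt, hle⟩ := klDiv_add_responseGap_decay (C := 2 / σ ^ 2 * C)
    (hf.const_mul (2 / σ ^ 2)) (fun x y => by
      rw [abs_mul, abs_of_pos (by positivity : 0 < 2 / σ ^ 2)]
      exact mul_le_mul_of_nonneg_left (hC x y) (by positivity)) hα hν hμ hν0 hμ0 ht
    ((hflow.ac_min t ht).trans (absolutelyContinuous_refMeasure hπ))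
    ((hflow.ac_max t ht).trans (absolutelyContinuous_refMeasure hρ))
  rw [niError_bilinearPayoff hf hC hσ hνt hμt, niError_bilinearPayoff hf hC hσ hν0 hμ0,
    ← EReal.coe_mul, EReal.coe_le_coe_iff, mul_left_comm]
  exact mul_le_mul_of_nonneg_left hle (by positivity)

end MFBR
end

theorem corollary2p4 {d : ℕ} (X Y : Set (EuclideanSpace ℝ (Fin d)))
    (hX : NullMeasurableSet X volume) (hY : NullMeasurableSet Y volume)
    (Uπ : X → ℝ) (Uρ : Y → ℝ) (hUπ : Measurable Uπ) (hUρ : Measurable Uρ)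
    (hπ : ∫ x, Real.exp (-Uπ x) = 1) (hρ : ∫ y, Real.exp (-Uρ y) = 1)
    (f : X → Y → ℝ) (hf : Measurable (Function.uncurry f)) (hfb : ∃ C : ℝ, ∀ x y, |f x y| ≤ C)
    (σ α : ℝ) (hσ : 0 < σ) (hα : 0 < α)
    (ν : ℝ → ProbabilityMeasure X) (μ : ℝ → ProbabilityMeasure Y)
    (hflow : MFBR.IsMFBRFlow (MFBR.bilinearPayoff f) Uπ Uρ σ α ν μ)
    (hNI : MFBR.niError (MFBR.bilinearPayoff f) Uπ Uρ σ (ν 0) (μ 0) < ⊤) :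
    ∀ t : ℝ, 0 ≤ t →
      MFBR.niError (MFBR.bilinearPayoff f) Uπ Uρ σ (ν t) (μ t) ≤
        (Real.exp (-α * t) : EReal) *
          MFBR.niError (MFBR.bilinearPayoff f) Uπ Uρ σ (ν 0) (μ 0) := by
  obtain ⟨C, hC⟩ := hfb
  exact fun t ht => hflow.niError_le hπ hρ hf hC hσ hα hNI ht
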